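/- **Conventions.** Let $d\in\mathbb N$. $|\cdot|$ is Lebesgue measure on $\mathbb R^d$, and $\mathbb R^{2d}=\mathbb R^d\times\mathbb R^d$. A *Cantor set* is a nonempty compact, totally disconnected, perfect set. A *finite tree* is a connected acyclic graph $T$ with finitely many vertices, with a designated root (labelled $0$). **Derivative condition.** Let $U\subset\mathbb R^{2d}$ be open. A map $\varphi:\mathbb R^{2d}\times\mathbb R^{2d}\to\mathbb R$ satisfies the derivative condition on $U$ if for every pair of distinct points $a,b\in U$ there are open sets $A,B\subset U$ with $a\in A$, $b\in B$ such that $\varphi$ is continuous on $A\times B$ and, for every $i\in\{1,\dots,2d\}$ with $a_i\neq b_i$, the partial derivative $\frac{\partial\varphi(x,y)}{\partial y_i}$ exists, is continuous and is nonzero for $(x,y)\in A\times B$. (In particular this holds if $\varphi$ is $C^1$ on $A\times B$ and all the $\partial\varphi/\partial y_i$, $1\le i\le 2d$, are nonvanishing on $A\times B$; it also holds for $\varphi(x,y)=|x-y|$ with $U=\mathbb R^{2d}$.) **Pinned $(\varphi,T)$ distance set.** For $X\subset\mathbb R^{2d}$ and $y\in X$, $\Delta^{\varphi,T}_y(X)$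 is the set of all vectors $\big(\varphi(x^{\tau},x^{\sigma})\big)_{(\tau,\sigma)}$, with one coordinate for each edge of $T$, where $\tau$ is the endpoint nearer to the root (the parent) and $\sigma$ the other one (the child), and where $\{x^\tau\}_{\tau\in T}$ ranges over the families of pairwise distinct points of $X$ with $x^0=y$. For a tree with $n$ vertices it is a subset of $\mathbb R^{n-1}$, and interior is taken there. **Theorem.** Let $\varphi:\mathbb R^{2d}\times\mathbb R^{2d}\to\mathbb R$ satisfy the derivative condition on an open set $U\subset\mathbb R^{2d}$, and let $K\subset\mathbb R^d$ be a Cantor set such that $U\cap(K\times\mathbb R^d)\neq\varnothing$. Then for every finite tree $T$ there exists a Cantor set $\widetilde K\subset\mathbb R^d$ with $|\widetilde K|>|K|$ such that $\Delta^{\varphi,T}_y(K\times\widetilde K)$ has nonempty interior for some $y\in K\times\widetilde K$. -/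

import Mathlib

open MeasureTheory Set

/-- A Cantor set in a topological space: a nonempty compact totally disconnected perfect subset
(`Perfect` : closed and without isolated points). -/
structure IsCantorSet {E : Type*} [TopologicalSpace E] (K : Set E) : Prop where
  nonempty : K.Nonempty
  isCompact : IsCompact K
  isTotallyDisconnected : IsTotallyDisconnected K
  perfect : Perfect K

/-- The partial derivative `∂φ(x, y) / ∂yᵢ` of a function `φ` of two vector variables with respect
to the `i`-th coordinate of the second one. It is `0` by convention where it does not exist, so
that `partialSnd φ i x y ≠ 0` contains the existence of the partial derivative. -/
noncomputable def partialSnd {m : ℕ}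
    (φ : EuclideanSpace ℝ (Fin m) → EuclideanSpace ℝ (Fin m) → ℝ) (i : Fin m)
    (x y : EuclideanSpace ℝ (Fin m)) : ℝ :=
  lineDeriv ℝ (φ x) y (EuclideanSpace.single i 1)

/-- The derivative condition for `φ : ℝᵐ × ℝᵐ → ℝ` on an open set `U ⊆ ℝᵐ`: every two distinct
points `a, b ∈ U` have open neighbourhoods `A, B ⊆ U` such that `φ` is continuous on `A × B` and,
for every coordinate `i` in which `a` and `b` differ, the partial derivative `∂φ(x, y) / ∂yᵢ`
exists, is continuous and does not vanish on `A × B`. -/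
structure DerivativeConditionOn {m : ℕ}
    (φ : EuclideanSpace ℝ (Fin m) → EuclideanSpace ℝ (Fin m) → ℝ)
    (U : Set (EuclideanSpace ℝ (Fin m))) : Prop where
  isOpen : IsOpen U
  exists_nhds : ∀ a ∈ U, ∀ b ∈ U, a ≠ b →
    ∃ A B : Set (EuclideanSpace ℝ (Fin m)),
      IsOpen A ∧ IsOpen B ∧ A ⊆ U ∧ B ⊆ U ∧ a ∈ A ∧ b ∈ B ∧
      ContinuousOn (fun p : EuclideanSpace ℝ (Fin m) × EuclideanSpace ℝ (Fin m) => φ p.1 p.2)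
        (A ×ˢ B) ∧
      ∀ i : Fin m, a i ≠ b i →
        (∀ x ∈ A, ∀ y ∈ B, partialSnd φ i x y ≠ 0) ∧
        ContinuousOn (fun p : EuclideanSpace ℝ (Fin m) × EuclideanSpace ℝ (Fin m) =>
          partialSnd φ i p.1 p.2) (A ×ˢ B)

/-- The product `K × L ⊆ ℝ²ᵈ` of two sets `K, L ⊆ ℝᵈ`: the points of `ℝ²ᵈ` whose first `d`
coordinates form a point of `K` and whose last `d` coordinates form a point of `L`. -/
def euclideanProd {d : ℕ} (K L : Set (EuclideanSpace ℝ (Fin d))) :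
    Set (EuclideanSpace ℝ (Fin (d + d))) :=
  {z | WithLp.toLp 2 (fun i : Fin d => z (Fin.castAdd d i)) ∈ K ∧
       WithLp.toLp 2 (fun i : Fin d => z (Fin.natAdd d i)) ∈ L}

/-- The edges of a tree `T` with root `r`, each directed away from the root: the pairs
`(τ, σ)` of adjacent vertices such that `τ` is the parent of `σ`. -/
def RootedEdge {V : Type*} (T : SimpleGraph V) (r : V) : Type _ :=
  {e : V × V // T.Adj e.1 e.2 ∧ T.dist r e.2 = T.dist r e.1 + 1}

/-- The pinned `(φ, T)` distance set of `X` with pin `y`, for a tree `T` with root `r`: the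
vectors `(φ(x_τ, x_σ))`, indexed by the edges with parent `τ` and child `σ`, where the `x_τ` are
distinct points of `X`, one for each vertex, and `x_r = y`. -/
def pinnedTreeSet {E V : Type*} (φ : E → E → ℝ) (T : SimpleGraph V) (r : V) (X : Set E) (y : E) :
    Set (RootedEdge T r → ℝ) :=
  {l | ∃ x : V → E, Function.Injective x ∧ (∀ τ, x τ ∈ X) ∧ x r = y ∧
    ∀ e : RootedEdge T r, l e = φ (x e.1.1) (x e.1.2)}

/-!
The set `K'` may be chosen freely, so it suffices to find a compact set `L` of points with
irrational coordinates for which the pinned distance set of `K × L` contains an open box: any such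
`L` lies in a Cantor set of arbitrarily large finite measure (`exists_isCantorSet_superset`). Total
disconnectedness is automatic for sets of points with irrational coordinates, and these points have
full measure.

Consider one edge, with base points `a` (parent) and `b` (child) that differ in two coordinates `i`
and `j`, where `j` belongs to the second factor. By Rolle's theorem `φ x` is injective along both
coordinate directions, so near `b` the equation `φ x w = t` has a solution obtained from `b` by
setting coordinate `i` to a prescribed `p` and coordinate `j` to a value `s` depending continuously
on `(x, t, p)` and injectively on `p`. Let `p` range over a perfect set. For fixed `(x, t)` and a
rational `q` each of the conditions `p = q` and `s = q` holds for at most one `p`. A compactness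
argument (`exists_isClosed_forall_exists_disjoint`) therefore gives a single compact set of
parameters that avoids all rationals and still contains a solution for every `(x, t)` near
`(a, φ a b)`. This is `exists_isCompact_forall_exists_eq`. Its uniformity in the parent `x` is what
makes the tree work: with radii around the base points chosen from the leaves to the root, every
vector of values in a box is realized by choosing the points from the root to the leaves
(`exists_family_of_forall_edge`).

For `d ≥ 2` both coordinates `i` and `j` lie in the second factor. For `d = 1` coordinate `i` is
that of `K`, and the perfectness of `K` provides the perfect set of parameters.
-/

/-! ### Selections avoiding countably many closed sets -/

/-- Each step shrinks a closed set `F ⊆ Z × P` to a finite union of closed boxes whose interiors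
still meet every fibre over `Z`, now away from `D n`; the boxes exist because a nonempty open subset
of a fibre is never contained in `D n`. -/
theorem exists_isClosed_forall_exists_disjoint {Z P : Type*} [TopologicalSpace Z]
    [TopologicalSpace P] [CompactSpace Z] [T2Space Z] [CompactSpace P] [T2Space P] [Nonempty P]
    (D : ℕ → Set (Z × P)) (hD : ∀ n, IsClosed (D n))
    (hint : ∀ n z, interior {p | (z, p) ∈ D n} = ∅) :
    ∃ C : Set (Z × P), IsClosed C ∧ (∀ z, ∃ p, (z, p) ∈ C) ∧ ∀ n, Disjoint C (D n) := by
  have step : ∀ n (F : {F : Set (Z × P) // IsClosed F ∧ ∀ z, ∃ p, (z, p) ∈ interior F}),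
      ∃ F' : {F : Set (Z × P) // IsClosed F ∧ ∀ z, ∃ p, (z, p) ∈ interior F},
        F'.1 ⊆ F.1 ∧ Disjoint F'.1 (D n) := by
    rintro n ⟨F, hF, hz⟩
    have key : ∀ z, ∃ N : Set (Z × P), IsClosed N ∧ N ⊆ F ∧ Disjoint N (D n) ∧
        ∃ p, (z, p) ∈ interior N := by
      intro z
      obtain ⟨p₀, hp₀⟩ := hz z
      have hO : IsOpen {p | (z, p) ∈ interior F} :=
        isOpen_interior.preimage (by fun_prop : Continuous fun p : P => (z, p))
      have : ∃ p, (z, p) ∈ interior F ∧ (z, p) ∉ D n := by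
        by_contra! hcon
        have : p₀ ∈ interior {p | (z, p) ∈ D n} :=
          mem_interior.2 ⟨_, fun p hp => hcon p hp, hO, hp₀⟩
        simp [hint] at this
      obtain ⟨p, hpF, hpD⟩ := this
      have hnhds : interior F ∩ (D n)ᶜ ∈ nhds (z, p) :=
        (isOpen_interior.inter (hD n).isOpen_compl).mem_nhds ⟨hpF, hpD⟩
      obtain ⟨N, hN, hNc, hNs⟩ := exists_mem_nhds_isClosed_subset hnhds
      exact ⟨N, hNc, fun x hx => interior_subset (hNs hx).1,
        disjoint_left.2 fun x hx => (hNs hx).2, p, mem_interior_iff_mem_nhds.2 hN⟩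
    choose N hNc hNF hND hNp using key
    obtain ⟨s, hs⟩ := isCompact_univ.elim_finite_subcover
      (fun z => Prod.fst '' interior (N z)) (fun z => isOpenMap_fst _ isOpen_interior)
      (fun z _ => by
        obtain ⟨p, hp⟩ := hNp z
        exact mem_iUnion.2 ⟨z, (z, p), hp, rfl⟩)
    refine ⟨⟨⋃ z ∈ s, N z, isClosed_biUnion_finset fun z _ => hNc z, fun z => ?_⟩,
      iUnion₂_subset fun z _ => hNF z, disjoint_iUnion₂_left.2 fun z _ => hND z⟩
    obtain ⟨z', hz's, ⟨_, p⟩, hp, rfl⟩ := mem_iUnion₂.1 (hs (mem_univ z))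
    exact ⟨p, interior_mono (subset_biUnion_of_mem (u := N) hz's) hp⟩
  choose next hsub hdisj using step
  let F : ℕ → {F : Set (Z × P) // IsClosed F ∧ ∀ z, ∃ p, (z, p) ∈ interior F} :=
    fun n => Nat.rec ⟨univ, isClosed_univ, fun z => by simp⟩ next n
  have hanti : Antitone fun n => (F n).1 := antitone_nat_of_succ_le fun n => hsub n (F n)
  refine ⟨⋂ n, (F n).1, isClosed_iInter fun n => (F n).2.1, fun z => ?_, fun n => ?_⟩
  · have hcl : ∀ n, IsClosed {p | (z, p) ∈ (F n).1} := fun n =>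
      (F n).2.1.preimage (by fun_prop : Continuous fun p : P => (z, p))
    obtain ⟨p, hp⟩ := IsCompact.nonempty_iInter_of_sequence_nonempty_isCompact_isClosed
      (fun n => {p | (z, p) ∈ (F n).1}) (fun n p hp => hanti n.le_succ hp)
      (fun n => by
        obtain ⟨p, hp⟩ := (F n).2.2 z
        exact ⟨p, interior_subset (s := (F n).1) hp⟩) (hcl 0).isCompact hcl
    exact ⟨p, mem_iInter.2 fun n => mem_iInter.1 hp n⟩
  · exact (hdisj n (F n)).mono_left (iInter_subset _ (n + 1))

/-- The preimage of a closed set is the projection, along the compact factor `Y`, of a closed subset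
of the graph. -/
theorem continuous_of_isClosed_graph {X Y : Type*} [TopologicalSpace X] [TopologicalSpace Y]
    [CompactSpace Y] {f : X → Y} (hf : IsClosed {q : X × Y | q.2 = f q.1}) : Continuous f := by
  refine continuous_iff_isClosed.2 fun D hD => ?_
  have : f ⁻¹' D = Prod.fst '' ({q : X × Y | q.2 = f q.1} ∩ Prod.snd ⁻¹' D) := by
    ext x
    constructor
    · intro hx
      exact ⟨(x, f x), ⟨rfl, hx⟩, rfl⟩
    · rintro ⟨⟨x, y⟩, ⟨h, hy⟩, rfl⟩
      change y = f x at h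
      subst h
      exact hy
  rw [this]
  exact isClosedMap_fst_of_compactSpace _ (hf.inter (hD.preimage continuous_snd))

/-! ### Moving two coordinates of a point -/

/-- The point `b` with its `i`-th coordinate replaced by `p` and its `j`-th one by `s`; for `i = j`
the value `s` prevails. -/
noncomputable def setTwo {m : ℕ} (b : EuclideanSpace ℝ (Fin m)) (i j : Fin m) (p s : ℝ) :
    EuclideanSpace ℝ (Fin m) :=
  WithLp.toLp 2 (Function.update (Function.update b.ofLp i p) j s)

section setTwo

variable {m : ℕ} (b : EuclideanSpace ℝ (Fin m)) {i j : Fin m}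

theorem setTwo_apply (i j k : Fin m) (p s : ℝ) :
    setTwo b i j p s k = if k = j then s else if k = i then p else b k := by
  simp [setTwo, Function.update_apply]

theorem setTwo_self (i j : Fin m) : setTwo b i j (b i) (b j) = b := by
  ext k
  rw [setTwo_apply]
  split_ifs with h1 h2 <;> simp [*]

theorem continuous_setTwo (i j : Fin m) : Continuous fun q : ℝ × ℝ => setTwo b i j q.1 q.2 := by
  refine (PiLp.continuous_toLp 2 _).comp (continuous_pi fun k => ?_)
  simp only [Function.update_apply]
  split_ifs <;> fun_prop

theorem setTwo_eq_add_fst (hij : i ≠ j) (p q s : ℝ) :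
    setTwo b i j q s = setTwo b i j p s + (q - p) • EuclideanSpace.single i 1 := by
  ext k
  simp only [PiLp.add_apply, PiLp.smul_apply, setTwo_apply, PiLp.single_apply]
  split_ifs with h1 h2 <;> simp_all

theorem setTwo_eq_add_snd (p s t : ℝ) :
    setTwo b i j p t = setTwo b i j p s + (t - s) • EuclideanSpace.single j 1 := by
  ext k
  simp only [PiLp.add_apply, PiLp.smul_apply, setTwo_apply, PiLp.single_apply]
  split_ifs with h1 h2 <;> simp_all

end setTwo

theorem injOn_of_lineDeriv_ne_zero {E : Type*} [NormedAddCommGroup E] [NormedSpace ℝ E]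
    {f : E → ℝ} {γ : ℝ → E} {v : E} (hγ : ∀ p q, γ q = γ p + (q - p) • v) {I : Set ℝ}
    [I.OrdConnected] (hc : ContinuousOn (fun t => f (γ t)) I)
    (h : ∀ t ∈ I, lineDeriv ℝ f (γ t) v ≠ 0) : InjOn (fun t => f (γ t)) I := by
  have hlt : ∀ p ∈ I, ∀ q ∈ I, p < q → f (γ p) ≠ f (γ q) := by
    intro p hp q hq hpq heq
    have hI : Icc p q ⊆ I := Set.OrdConnected.out ‹_› hp hq
    obtain ⟨c, hc', h0⟩ := exists_deriv_eq_zero hpq (hc.mono hI) heq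
    refine h c (hI (Ioo_subset_Icc_self hc')) ?_
    have h1 : (fun t : ℝ => f (γ c + t • v)) = fun t => f (γ (c + t)) := by
      funext t
      rw [hγ c (c + t), add_sub_cancel_left]
    rw [lineDeriv, h1, deriv_comp_const_add (fun t => f (γ t)), add_zero]
    exact h0
  intro p hp q hq heq
  by_contra hne
  rcases lt_or_gt_of_ne hne with h1 | h1
  · exact hlt p hp q hq h1 heq
  · exact hlt q hq p hp h1 heq.symm

theorem Preperfect.perfectSpace_subtype {X : Type*} [TopologicalSpace X] {s : Set X}
    (hs : Preperfect s) : PerfectSpace s := by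
  refine ⟨preperfect_iff_nhds.2 fun x _ U hU => ?_⟩
  obtain ⟨W, hW, hWU⟩ := mem_nhds_subtype s x U |>.1 hU
  obtain ⟨y, ⟨hyW, hys⟩, hyx⟩ := preperfect_iff_nhds.1 hs x x.2 W hW
  exact ⟨⟨y, hys⟩, ⟨hWU hyW, mem_univ _⟩, fun h => hyx (congrArg Subtype.val h)⟩

/-- A scalar implicit function theorem without smoothness: an equation `ψ x p s = t` whose left
side is continuous and injective in `s` is solved near a given solution by a continuous function
`g` of `(x, t, p)`. -/
theorem exists_continuous_implicit {E : Type*} [MetricSpace E] [ProperSpace E] {ψ : E → ℝ → ℝ → ℝ}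
    {a : E} {p₀ s₀ η : ℝ} (hη : 0 < η)
    (hc : ContinuousOn (fun q : E × ℝ × ℝ => ψ q.1 q.2.1 q.2.2)
      (Metric.closedBall a η ×ˢ Metric.closedBall p₀ η ×ˢ Icc (s₀ - η) (s₀ + η)))
    (hs : ∀ x ∈ Metric.closedBall a η, ∀ p ∈ Metric.closedBall p₀ η,
      InjOn (ψ x p) (Icc (s₀ - η) (s₀ + η))) :
    ∃ ε > 0, ε ≤ η ∧ ∃ g : (Metric.closedBall a ε × Metric.closedBall (ψ a p₀ s₀) ε) ×
      Metric.closedBall p₀ ε → Icc (s₀ - η) (s₀ + η),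
      Continuous g ∧ ∀ q, ψ q.1.1 q.2 (g q) = q.1.2 := by
  set J := Icc (s₀ - η) (s₀ + η) with hJ
  set t₀ := ψ a p₀ s₀ with ht₀
  have haη : a ∈ Metric.closedBall a η := Metric.mem_closedBall_self hη.le
  have hpη : p₀ ∈ Metric.closedBall p₀ η := Metric.mem_closedBall_self hη.le
  have hm : s₀ - η ∈ J := ⟨le_rfl, by linarith⟩
  have hM : s₀ + η ∈ J := ⟨by linarith, le_rfl⟩
  have h0 : s₀ ∈ J := ⟨by linarith, by linarith⟩
  -- the values at the two ends of `J` lie strictly on opposite sides of `t`: an open condition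
  let Q : E × ℝ × ℝ → ℝ := fun q =>
    (ψ q.1 q.2.1 (s₀ - η) - q.2.2) * (ψ q.1 q.2.1 (s₀ + η) - q.2.2)
  have hcs : ∀ x ∈ Metric.closedBall a η, ∀ p ∈ Metric.closedBall p₀ η,
      ContinuousOn (ψ x p) J := fun x hx p hp =>
    hc.comp (f := fun s : ℝ => (x, p, s)) (by fun_prop) fun s hs' => ⟨hx, hp, hs'⟩
  have hQneg : Q (a, p₀, t₀) < 0 := by
    have h1 : s₀ - η < s₀ := by linarith
    have h2 : s₀ < s₀ + η := by linarith
    rcases ContinuousOn.strictMonoOn_of_injOn_Icc' (by linarith : s₀ - η ≤ s₀ + η)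
      (hcs a haη p₀ hpη) (hs a haη p₀ hpη) with h | h
    · exact mul_neg_of_neg_of_pos (sub_neg.2 (h hm h0 h1)) (sub_pos.2 (h h0 hM h2))
    · exact mul_neg_of_pos_of_neg (sub_pos.2 (h hm h0 h1)) (sub_neg.2 (h h0 hM h2))
  have hψend : ∀ s ∈ J, ContinuousAt (fun q : E × ℝ × ℝ => ψ q.1 q.2.1 s) (a, p₀, t₀) := by
    intro s hsJ
    have hon : ContinuousOn (fun q : E × ℝ × ℝ => ψ q.1 q.2.1 s)
        (Metric.closedBall a η ×ˢ Metric.closedBall p₀ η ×ˢ univ) :=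
      hc.comp (f := fun q : E × ℝ × ℝ => (q.1, q.2.1, s)) (by fun_prop)
        fun q hq => ⟨hq.1, hq.2.1, hsJ⟩
    exact hon.continuousAt (prod_mem_nhds (Metric.closedBall_mem_nhds _ hη)
      (prod_mem_nhds (Metric.closedBall_mem_nhds _ hη) Filter.univ_mem))
  have hQc : ContinuousAt Q (a, p₀, t₀) :=
    ((hψend _ hm).sub (by fun_prop)).mul ((hψend _ hM).sub (by fun_prop))
  obtain ⟨ε, hε, hεQ⟩ := Metric.nhds_basis_closedBall.mem_iff.1
    (hQc.eventually (gt_mem_nhds hQneg))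
  refine ⟨min ε η, lt_min hε hη, min_le_right _ _, ?_⟩
  have hsol : ∀ q : (Metric.closedBall a (min ε η) × Metric.closedBall t₀ (min ε η)) ×
      Metric.closedBall p₀ (min ε η), ∃ s : J, ψ q.1.1 q.2 s = q.1.2 := by
    rintro ⟨⟨⟨x, hx⟩, t, ht⟩, p, hp⟩
    have hneg : Q (x, p, t) < 0 := by
      refine hεQ ?_
      rw [Metric.mem_closedBall] at hx ht hp ⊢
      rw [Prod.dist_eq, Prod.dist_eq]
      exact max_le (hx.trans (min_le_left _ _))
        (max_le (hp.trans (min_le_left _ _)) (ht.trans (min_le_left _ _)))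
    have hx' := Metric.closedBall_subset_closedBall (min_le_right ε η) hx
    have hp' := Metric.closedBall_subset_closedBall (min_le_right ε η) hp
    have huIcc : uIcc (s₀ - η) (s₀ + η) = J := uIcc_of_le (by linarith)
    have hmem : t ∈ uIcc (ψ x p (s₀ - η)) (ψ x p (s₀ + η)) := by
      rcases mul_neg_iff.1 hneg with ⟨h1, h2⟩ | ⟨h1, h2⟩
      · exact mem_uIcc.2 (Or.inr ⟨(sub_neg.1 h2).le, (sub_pos.1 h1).le⟩)
      · exact mem_uIcc.2 (Or.inl ⟨(sub_neg.1 h1).le, (sub_pos.1 h2).le⟩)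
    obtain ⟨s, hsJ, hst⟩ := intermediate_value_uIcc (huIcc ▸ hcs x hx' p hp') hmem
    exact ⟨⟨s, huIcc ▸ hsJ⟩, hst⟩
  choose g hg using hsol
  refine ⟨g, continuous_of_isClosed_graph ?_, hg⟩
  have hgraph : {q : ((Metric.closedBall a (min ε η) × Metric.closedBall t₀ (min ε η)) ×
      Metric.closedBall p₀ (min ε η)) × J | q.2 = g q.1} =
      {q | ψ q.1.1.1 q.1.2 q.2 = q.1.1.2} := by
    ext ⟨q, s⟩
    refine ⟨fun h => ?_, fun h => ?_⟩
    · change s = g q at h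
      subst h
      exact hg q
    · have hx' := Metric.closedBall_subset_closedBall (min_le_right ε η) q.1.1.2
      have hp' := Metric.closedBall_subset_closedBall (min_le_right ε η) q.2.2
      exact Subtype.ext (hs _ hx' _ hp' s.2 (g q).2 (Eq.trans h (hg q).symm))
  rw [hgraph]
  refine isClosed_eq ?_ (by fun_prop)
  exact hc.comp_continuous (f := fun q : ((Metric.closedBall a (min ε η) ×
      Metric.closedBall t₀ (min ε η)) × Metric.closedBall p₀ (min ε η)) × J =>
      ((q.1.1.1 : E), (q.1.2 : ℝ), (q.2 : ℝ))) (by fun_prop) fun q =>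
    ⟨Metric.closedBall_subset_closedBall (min_le_right ε η) q.1.1.1.2,
      Metric.closedBall_subset_closedBall (min_le_right ε η) q.1.2.2, q.2.2⟩

/-! ### Solving along one edge -/

/-- One edge of the tree: near `b` there is a compact set `M`, contained in the slice
`{setTwo b i j p s}` with `p ∈ S` and both moved coordinates irrational, such that every value `t`
close to `φ a b` is attained on `M` by `φ x`, uniformly for `x` close to `a`. -/
theorem exists_isCompact_forall_exists_eq {m : ℕ}
    {φ : EuclideanSpace ℝ (Fin m) → EuclideanSpace ℝ (Fin m) → ℝ}
    {A B : Set (EuclideanSpace ℝ (Fin m))} (hA : IsOpen A) (hB : IsOpen B)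
    {a b : EuclideanSpace ℝ (Fin m)} (ha : a ∈ A) (hb : b ∈ B)
    (hφ : ContinuousOn (fun p : EuclideanSpace ℝ (Fin m) × EuclideanSpace ℝ (Fin m) => φ p.1 p.2)
      (A ×ˢ B)) {i j : Fin m} (hij : i ≠ j)
    (hi : ∀ x ∈ A, ∀ y ∈ B, partialSnd φ i x y ≠ 0)
    (hj : ∀ x ∈ A, ∀ y ∈ B, partialSnd φ j x y ≠ 0)
    {S : Set ℝ} (hS : Perfect S) (hbS : b i ∈ S) {r : ℝ} (hr : 0 < r) :
    ∃ r' > 0, ∃ J : Set ℝ, IsOpen J ∧ J.Nonempty ∧ ∃ M : Set (EuclideanSpace ℝ (Fin m)),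
      IsCompact M ∧ M ⊆ Metric.closedBall b r ∧
      (∀ w ∈ M, ∃ p ∈ S, ∃ s, Irrational p ∧ Irrational s ∧ w = setTwo b i j p s) ∧
      ∀ x ∈ Metric.closedBall a r', ∀ t ∈ J, ∃ w ∈ M, φ x w = t := by
  set p₀ := b i with hp₀
  set s₀ := b j with hs₀
  obtain ⟨ηA, hηA, hηAsub⟩ := Metric.nhds_basis_closedBall.mem_iff.1 (hA.mem_nhds ha)
  have hnhds : (fun q : ℝ × ℝ => setTwo b i j q.1 q.2) ⁻¹' (B ∩ Metric.closedBall b r) ∈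
      nhds (p₀, s₀) := by
    refine (continuous_setTwo b i j).continuousAt.preimage_mem_nhds ?_
    change _ ∈ nhds (setTwo b i j (b i) (b j))
    rw [setTwo_self]
    exact Filter.inter_mem (hB.mem_nhds hb) (Metric.closedBall_mem_nhds _ hr)
  obtain ⟨ηB, hηB, hηBsub⟩ := Metric.nhds_basis_closedBall.mem_iff.1 hnhds
  set η := min ηA ηB with hηdef
  have hη : 0 < η := lt_min hηA hηB
  have hxA : ∀ x ∈ Metric.closedBall a η, x ∈ A := fun x hx =>
    hηAsub (Metric.closedBall_subset_closedBall (min_le_left _ _) hx)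
  have hps : ∀ p ∈ Metric.closedBall p₀ η, ∀ s ∈ Icc (s₀ - η) (s₀ + η),
      setTwo b i j p s ∈ B ∩ Metric.closedBall b r := by
    intro p hp s hs
    have hmem : (p, s) ∈ Metric.closedBall (p₀, s₀) ηB := by
      rw [← Real.closedBall_eq_Icc] at hs
      rw [Metric.mem_closedBall] at hp hs ⊢
      rw [Prod.dist_eq]
      exact max_le (hp.trans (min_le_right _ _)) (hs.trans (min_le_right _ _))
    exact hηBsub hmem
  let ψ : EuclideanSpace ℝ (Fin m) → ℝ → ℝ → ℝ := fun x p s => φ x (setTwo b i j p s)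
  have hψ : ContinuousOn (fun q : EuclideanSpace ℝ (Fin m) × ℝ × ℝ => ψ q.1 q.2.1 q.2.2)
      (Metric.closedBall a η ×ˢ Metric.closedBall p₀ η ×ˢ Icc (s₀ - η) (s₀ + η)) :=
    hφ.comp (f := fun q : EuclideanSpace ℝ (Fin m) × ℝ × ℝ => (q.1, setTwo b i j q.2.1 q.2.2))
      (continuous_fst.prodMk ((continuous_setTwo b i j).comp continuous_snd)).continuousOn
      fun q hq => ⟨hxA _ hq.1, (hps _ hq.2.1 _ hq.2.2).1⟩
  have hinjs : ∀ x ∈ Metric.closedBall a η, ∀ p ∈ Metric.closedBall p₀ η,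
      InjOn (ψ x p) (Icc (s₀ - η) (s₀ + η)) := fun x hx p hp =>
    injOn_of_lineDeriv_ne_zero (f := φ x) (setTwo_eq_add_snd b p)
      (hψ.comp (f := fun s : ℝ => (x, p, s)) (by fun_prop) fun s hs' => ⟨hx, hp, hs'⟩)
      fun s hs => hj x (hxA x hx) _ (hps p hp s hs).1
  have hinjp : ∀ x ∈ Metric.closedBall a η, ∀ s ∈ Icc (s₀ - η) (s₀ + η),
      InjOn (fun p => ψ x p s) (Metric.closedBall p₀ η) := fun x hx s hs =>
    have : (Metric.closedBall p₀ η).OrdConnected := by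
      rw [Real.closedBall_eq_Icc]
      exact ordConnected_Icc
    injOn_of_lineDeriv_ne_zero (f := φ x) (fun p q => setTwo_eq_add_fst b hij p q s)
      (hψ.comp (f := fun p : ℝ => (x, p, s)) (by fun_prop) fun p hp => ⟨hx, hp, hs⟩)
      fun p hp => hi x (hxA x hx) _ (hps p hp s hs).1
  obtain ⟨ε, hε, hεη, g, hgc, hg⟩ := exists_continuous_implicit hη hψ hinjs
  set P := closure (Metric.ball p₀ ε ∩ S) with hP
  obtain ⟨hPperf, p₁, hp₁⟩ := hS.closure_nhds_inter p₀ hbS (Metric.mem_ball_self hε)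
    Metric.isOpen_ball
  have hPS : P ⊆ S := closure_minimal inter_subset_right hS.closed
  have hPball : P ⊆ Metric.closedBall p₀ ε :=
    closure_minimal (inter_subset_left.trans Metric.ball_subset_closedBall)
      Metric.isClosed_closedBall
  have hPc : IsCompact P := (isCompact_closedBall p₀ ε).of_isClosed_subset isClosed_closure hPball
  have : CompactSpace P := isCompact_iff_compactSpace.1 hPc
  have : PerfectSpace P := hPperf.acc.perfectSpace_subtype
  have : Nonempty P := ⟨⟨p₁, hp₁⟩⟩
  let Z := Metric.closedBall a ε × Metric.closedBall (ψ a p₀ s₀) ε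
  let h : Z × P → ℝ := fun q => g (q.1, inclusion hPball q.2)
  have hhc : Continuous h := continuous_subtype_val.comp (hgc.comp
    (continuous_fst.prodMk ((continuous_inclusion hPball).comp continuous_snd)))
  have hhJ : ∀ q, h q ∈ Icc (s₀ - η) (s₀ + η) := fun q => (g _).2
  have hh : ∀ q : Z × P, φ q.1.1 (setTwo b i j q.2 (h q)) = q.1.2 := fun q =>
    hg (q.1, inclusion hPball q.2)
  -- for fixed `(x, t)` the solution `s` determines `p`, as `φ x` is injective along both axes
  have hhinj : ∀ z, Function.Injective fun p => h (z, p) := by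
    intro z p p' hpp
    have hpp' : h (z, p) = h (z, p') := hpp
    have h1 := hh (z, p)
    have h2 := hh (z, p')
    rw [← hpp'] at h2
    exact Subtype.ext (hinjp z.1 (Metric.closedBall_subset_closedBall hεη z.1.2) _ (hhJ (z, p))
      (Metric.closedBall_subset_closedBall hεη (hPball p.2))
      (Metric.closedBall_subset_closedBall hεη (hPball p'.2)) (h1.trans h2.symm))
  obtain ⟨e, he⟩ := exists_surjective_nat ℚ
  obtain ⟨C, hC, hCz, hCD⟩ := exists_isClosed_forall_exists_disjoint
    (fun n => {q : Z × P | (q.2 : ℝ) = e n} ∪ {q | h q = e n})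
    (fun n => (isClosed_eq (by fun_prop) (by fun_prop)).union
      (isClosed_eq hhc (by fun_prop))) (fun n z => by
        have hfin : {p : P | (z, p) ∈ {q : Z × P | (q.2 : ℝ) = e n} ∪ {q | h q = e n}}.Finite := by
          refine Set.Finite.union (s := {p : P | (p : ℝ) = e n}) (t := {p : P | h (z, p) = e n})
            (Set.Subsingleton.finite ?_) (Set.Subsingleton.finite ?_)
          · intro p hp p' hp'
            exact Subtype.ext (Eq.trans hp (Eq.symm hp'))
          · intro p hp p' hp'
            exact hhinj z (Eq.trans hp (Eq.symm hp'))
        refine eq_empty_iff_forall_notMem.2 fun p hp => ?_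
        exact infinite_of_mem_nhds p (mem_interior_iff_mem_nhds.1 hp) hfin)
  have hGc : Continuous fun q : Z × P => setTwo b i j q.2 (h q) :=
    (continuous_setTwo b i j).comp
      ((continuous_subtype_val.comp continuous_snd).prodMk hhc)
  refine ⟨ε, hε, Metric.ball (ψ a p₀ s₀) ε, Metric.isOpen_ball, ⟨_, Metric.mem_ball_self hε⟩,
    (fun q : Z × P => setTwo b i j q.2 (h q)) '' C, hC.isCompact.image hGc, ?_, ?_, ?_⟩
  · rintro _ ⟨q, -, rfl⟩
    exact (hps _ (Metric.closedBall_subset_closedBall hεη (hPball q.2.2)) _ (hhJ q)).2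
  · rintro _ ⟨q, hq, rfl⟩
    refine ⟨q.2, hPS q.2.2, h q, ?_, ?_, rfl⟩
    · rintro ⟨c, hc⟩
      obtain ⟨n, rfl⟩ := he c
      exact disjoint_left.1 (hCD n) hq (Or.inl hc.symm)
    · rintro ⟨c, hc⟩
      obtain ⟨n, rfl⟩ := he c
      exact disjoint_left.1 (hCD n) hq (Or.inr hc.symm)
  · intro x hx t ht
    let z : Z := (⟨x, hx⟩, ⟨t, Metric.ball_subset_closedBall ht⟩)
    obtain ⟨p, hp⟩ := hCz z
    exact ⟨_, mem_image_of_mem _ hp, hh (z, p)⟩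

/-! ### Cantor sets with irrational coordinates -/

/-- The points of `ℝᵈ` all of whose coordinates are irrational. -/
def irrationalPoints (d : ℕ) : Set (EuclideanSpace ℝ (Fin d)) :=
  {v | ∀ k, Irrational (v k)}

theorem isTotallyDisconnected_of_subset_irrationalPoints {d : ℕ}
    {s : Set (EuclideanSpace ℝ (Fin d))} (hs : s ⊆ irrationalPoints d) :
    IsTotallyDisconnected s := by
  intro c hcs hc
  have hlt : ∀ x ∈ c, ∀ y ∈ c, ∀ k, ¬ x k < y k := by
    intro x hx y hy k hlt
    obtain ⟨q, hq1, hq2⟩ := exists_rat_btwn hlt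
    have himg : IsPreconnected ((fun v : EuclideanSpace ℝ (Fin d) => v k) '' c) :=
      hc.image _ (by fun_prop)
    obtain ⟨z, hz, hzq⟩ := himg.ordConnected.out ⟨x, hx, rfl⟩ ⟨y, hy, rfl⟩ ⟨hq1.le, hq2.le⟩
    exact hs (hcs hz) k ⟨q, hzq.symm⟩
  intro x hx y hy
  ext k
  exact le_antisymm (not_lt.1 (hlt y hy x hx k)) (not_lt.1 (hlt x hx y hy k))

theorem ae_mem_irrationalPoints (d : ℕ) :
    ∀ᵐ v : EuclideanSpace ℝ (Fin d), v ∈ irrationalPoints d := by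
  have hpi : ∀ᵐ v : Fin d → ℝ, ∀ k, Irrational (v k) := by
    refine ae_all_iff.2 fun k => ?_
    have hnull : ∀ᵐ x : ℝ, Irrational x := (countable_range _).ae_notMem volume
    exact (Measure.tendsto_eval_ae_ae (μ := fun _ : Fin d => volume) (i := k)).eventually hnull
  exact (PiLp.volume_preserving_ofLp (Fin d)).quasiMeasurePreserving.ae hpi

theorem measurableSet_irrationalPoints (d : ℕ) : MeasurableSet (irrationalPoints d) := by
  have : irrationalPoints d = ⋂ k, (fun v : EuclideanSpace ℝ (Fin d) => v k) ⁻¹'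
      {x | Irrational x} := by
    ext v
    simp [irrationalPoints]
  rw [this]
  refine MeasurableSet.iInter fun k => ?_
  have hm : MeasurableSet {x : ℝ | Irrational x} := (countable_range _).measurableSet.compl
  exact (by fun_prop : Measurable fun v : EuclideanSpace ℝ (Fin d) => v k) hm

/-- Inner regularity gives a compact set, and the Cantor–Bendixson theorem removes its countable
scattered part. -/
theorem exists_perfect_subset_irrationalPoints {d : ℕ} (hd : 0 < d)
    {O : Set (EuclideanSpace ℝ (Fin d))} (hO : IsOpen O) {c : ENNReal} (hc : c < volume O) :
    ∃ M, IsCompact M ∧ Perfect M ∧ M ⊆ O ∧ M ⊆ irrationalPoints d ∧ c < volume M := by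
  have : Nonempty (Fin d) := ⟨⟨0, hd⟩⟩
  have hvol : volume (O ∩ irrationalPoints d) = volume O :=
    measure_inter_conull (ae_mem_irrationalPoints d)
  obtain ⟨M₀, hsub, hM₀, hM₀c⟩ :=
    (hO.measurableSet.inter (measurableSet_irrationalPoints d)).exists_lt_isCompact
      (hvol.symm ▸ hc)
  obtain ⟨N, M, hN, hM, hNM⟩ := exists_countable_union_perfect_of_isClosed hM₀.isClosed
  have hMM₀ : M ⊆ M₀ := hNM ▸ subset_union_right
  refine ⟨M, hM₀.of_isClosed_subset hM.closed hMM₀, hM, fun x hx => (hsub (hMM₀ hx)).1,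
    fun x hx => (hsub (hMM₀ hx)).2, hM₀c.trans_le ?_⟩
  calc volume M₀ ≤ volume N + volume M := hNM ▸ measure_union_le _ _
    _ = volume M := by rw [hN.measure_zero, zero_add]

/-- A compact set of points with irrational coordinates is made perfect by adding a sequence of
perfect sets that shrink to the points of a dense sequence, and of large measure by adding one more
perfect set. -/
theorem exists_isCantorSet_superset {d : ℕ} (hd : 0 < d) {L : Set (EuclideanSpace ℝ (Fin d))}
    (hL : IsCompact L) (hne : L.Nonempty) (hirr : L ⊆ irrationalPoints d) {c : ENNReal}
    (hc : c < ⊤) : ∃ K', IsCantorSet K' ∧ L ⊆ K' ∧ c < volume K' := by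
  have : Nonempty (Fin d) := ⟨⟨0, hd⟩⟩
  have : Nonempty L := hne.to_subtype
  obtain ⟨u, hu⟩ := TopologicalSpace.exists_dense_seq L
  -- each term of the dense sequence is used for infinitely many of the shrinking sets
  have hball : ∀ k : ℕ, ∃ M, IsCompact M ∧ Perfect M ∧
      M ⊆ Metric.ball (u k.unpair.1 : EuclideanSpace ℝ (Fin d)) (1 / (k + 1)) ∧
      M ⊆ irrationalPoints d ∧ 0 < volume M := fun k =>
    exists_perfect_subset_irrationalPoints hd Metric.isOpen_ball
      (Metric.measure_ball_pos _ _ (by positivity))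
  choose M hMc hMp hMball hMirr hMpos using hball
  obtain ⟨M', hM'c, hM'p, -, hM'irr, hM'vol⟩ :=
    exists_perfect_subset_irrationalPoints hd isOpen_univ (c := c) (by
      rwa [measure_univ_of_isAddLeftInvariant])
  have hcth : ∀ k N : ℕ, N ≤ k → M k ⊆ Metric.cthickening (1 / (N + 1)) L := by
    intro k N hNk x hx
    refine Metric.mem_cthickening_of_dist_le x (u k.unpair.1) _ _ (u k.unpair.1).2 ?_
    exact (hMball k hx).le.trans (one_div_le_one_div_of_le (by positivity) (by gcongr))
  have hclosed : IsClosed (L ∪ ⋃ k, M k) := by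
    have heq : L ∪ ⋃ k, M k =
        ⋂ N : ℕ, (Metric.cthickening (1 / (N + 1)) L ∪ ⋃ k ∈ Finset.range N, M k) := by
      refine subset_antisymm (subset_iInter fun N => union_subset ?_ (iUnion_subset fun k => ?_))
        fun x hx => ?_
      · exact (Metric.self_subset_cthickening L).trans subset_union_left
      · rcases lt_or_ge k N with h | h
        · exact (subset_biUnion_of_mem (u := M) (Finset.mem_range.2 h)).trans subset_union_right
        · exact (hcth k N h).trans subset_union_left
      · by_cases hxM : x ∈ ⋃ k, M k
        · exact Or.inr hxM
        · left
          have hxN : ∀ N : ℕ, Metric.infDist x L ≤ 1 / (N + 1) := by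
            intro N
            rcases mem_iInter.1 hx N with h | h
            · exact ENNReal.toReal_le_of_le_ofReal (by positivity) (Metric.mem_cthickening_iff.1 h)
            · obtain ⟨k, -, hk⟩ := mem_iUnion₂.1 h
              exact absurd (mem_iUnion.2 ⟨k, hk⟩) hxM
          rw [hL.isClosed.mem_iff_infDist_zero hne]
          exact le_antisymm (ge_of_tendsto' tendsto_one_div_add_atTop_nhds_zero_nat hxN)
            Metric.infDist_nonneg
    rw [heq]
    exact isClosed_iInter fun N => Metric.isClosed_cthickening.union
      (isClosed_biUnion_finset fun k _ => (hMc k).isClosed)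
  have hcompact : IsCompact (L ∪ ⋃ k, M k) := by
    refine (hL.cthickening (r := 1 / ((0 : ℕ) + 1))).of_isClosed_subset hclosed
      (union_subset (Metric.self_subset_cthickening L) (iUnion_subset fun k => ?_))
    exact hcth k 0 (Nat.zero_le k)
  have hacc : ∀ {x : EuclideanSpace ℝ (Fin d)} {s : Set (EuclideanSpace ℝ (Fin d))},
      AccPt x (Filter.principal s) → s ⊆ (L ∪ ⋃ k, M k) ∪ M' →
        AccPt x (Filter.principal ((L ∪ ⋃ k, M k) ∪ M')) :=
    fun h hs => h.mono (Filter.principal_mono.2 hs)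
  have hMsub : ∀ k, M k ⊆ (L ∪ ⋃ k, M k) ∪ M' := fun k x hx =>
    Or.inl (Or.inr (mem_iUnion.2 ⟨k, hx⟩))
  refine ⟨(L ∪ ⋃ k, M k) ∪ M', ⟨hne.mono fun x hx => Or.inl (Or.inl hx), hcompact.union hM'c,
    isTotallyDisconnected_of_subset_irrationalPoints
      (union_subset (union_subset hirr (iUnion_subset hMirr)) hM'irr),
    (hcompact.union hM'c).isClosed, ?_⟩, fun x hx => Or.inl (Or.inl hx),
    hM'vol.trans_le (measure_mono subset_union_right)⟩
  rintro x ((hx | hx) | hx)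
  · rw [accPt_iff_nhds]
    intro U hU
    obtain ⟨ε, hε, hεU⟩ := Metric.mem_nhds_iff.1 hU
    obtain ⟨n, hn⟩ := hu.exists_dist_lt ⟨x, hx⟩ (half_pos hε)
    obtain ⟨l, hl⟩ := exists_nat_one_div_lt (half_pos hε)
    set k := Nat.pair n l with hk
    have hkU : M k ⊆ U := by
      intro y hy
      refine hεU ?_
      have h1 := hMball k hy
      rw [hk, Nat.unpair_pair, Metric.mem_ball] at h1
      have h2 : (1 : ℝ) / ((Nat.pair n l : ℕ) + 1) ≤ 1 / (l + 1) :=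
        one_div_le_one_div_of_le (by positivity) (by
          have : l ≤ Nat.pair n l := Nat.right_le_pair n l
          gcongr)
      have h3 : dist x (u n) < ε / 2 := hn
      rw [Metric.mem_ball]
      calc dist y x ≤ dist y (u n) + dist x (u n) := dist_triangle_right _ _ _
        _ < ε := by linarith
    have hMne : (M k).Nonempty := nonempty_of_measure_ne_zero (hMpos k).ne'
    obtain ⟨y, hy⟩ := hMne
    by_cases hyx : y = x
    · obtain ⟨z, ⟨hzU, hz⟩, hzx⟩ := accPt_iff_nhds.1 ((hMp k).acc y hy) U (hyx ▸ hU)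
      exact ⟨z, ⟨hzU, hMsub k hz⟩, hyx ▸ hzx⟩
    · exact ⟨y, ⟨hkU hy, hMsub k hy⟩, hyx⟩
  · obtain ⟨k, hk⟩ := mem_iUnion.1 hx
    exact hacc ((hMp k).acc x hk) (hMsub k)
  · exact hacc (hM'p.acc x hx) subset_union_right

/-! ### Building families of points along a rooted tree -/

namespace SimpleGraph

variable {V : Type*} {T : SimpleGraph V}

theorem IsTree.eq_of_adj_of_dist_eq_add_one (hT : T.IsTree) {r σ τ τ' : V}
    (h : T.Adj τ σ) (hd : T.dist r σ = T.dist r τ + 1)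
    (h' : T.Adj τ' σ) (hd' : T.dist r σ = T.dist r τ' + 1) : τ = τ' := by
  obtain ⟨p, hp⟩ := hT.connected.exists_walk_length_eq_dist r τ
  obtain ⟨q, hq⟩ := hT.connected.exists_walk_length_eq_dist r τ'
  have hp' : (p.concat h).IsPath :=
    Walk.isPath_of_length_eq_dist _ (by rw [Walk.length_concat, hp, hd])
  have hq' : (q.concat h').IsPath :=
    Walk.isPath_of_length_eq_dist _ (by rw [Walk.length_concat, hq, hd'])
  have heq := (hT.existsUnique_path r σ).unique hp' hq'
  simpa using congrArg Walk.penultimate heq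

theorem Connected.exists_adj_dist_eq_add_one (hT : T.Connected) {r σ : V} (hσ : σ ≠ r) :
    ∃ τ, T.Adj τ σ ∧ T.dist r σ = T.dist r τ + 1 := by
  obtain ⟨p, hp⟩ := hT.exists_walk_length_eq_dist r σ
  have hnil : ¬ p.Nil := Walk.not_nil_of_ne hσ.symm
  have hadj := p.adj_penultimate hnil
  refine ⟨p.penultimate, hadj, le_antisymm ?_ ?_⟩
  · exact (hT.dist_triangle (v := p.penultimate)).trans_eq (by rw [dist_eq_one_iff_adj.2 hadj])
  · have h1 := dist_le p.dropLast
    have h2 : p.length ≠ 0 := fun h => hnil (Walk.length_eq_zero_iff.1 h)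
    have h3 : p.dropLast.length = p.length - 1 := by simp
    omega

end SimpleGraph

/-- A point at the root propagates along the edges to all vertices, because in a tree each
vertex other than the root is the child of exactly one edge. -/
theorem exists_family_of_forall_edge {V E : Type*} {T : SimpleGraph V} (hT : T.IsTree) (r : V)
    (B : V → Set E) (R : RootedEdge T r → E → E → Prop) {x₀ : E} (hx₀ : x₀ ∈ B r)
    (h : ∀ e : RootedEdge T r, ∀ x ∈ B e.1.1, ∃ w ∈ B e.1.2, R e x w) :
    ∃ x : V → E, x r = x₀ ∧ (∀ v, x v ∈ B v) ∧ ∀ e : RootedEdge T r, R e (x e.1.1) (x e.1.2) := by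
  have hedge : ∀ e e' : RootedEdge T r, e.1.2 = e'.1.2 → e = e' := by
    rintro ⟨⟨τ, σ⟩, h1, h2⟩ ⟨⟨τ', σ'⟩, h1', h2'⟩ heq
    change σ = σ' at heq
    subst heq
    have := hT.eq_of_adj_of_dist_eq_add_one h1 h2 h1' h2'
    change τ = τ' at this
    subst this
    rfl
  have hnext : ∀ σ : V, ∃ (τ : V) (f : E → E), ∀ e : RootedEdge T r, e.1.2 = σ →
      e.1.1 = τ ∧ ∀ x ∈ B e.1.1, f x ∈ B e.1.2 ∧ R e x (f x) := by
    intro σ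
    by_cases hσ : ∃ e : RootedEdge T r, e.1.2 = σ
    · obtain ⟨e, rfl⟩ := hσ
      have : ∀ x, ∃ w, x ∈ B e.1.1 → w ∈ B e.1.2 ∧ R e x w := by
        intro x
        by_cases hx : x ∈ B e.1.1
        · obtain ⟨w, hw⟩ := h e x hx
          exact ⟨w, fun _ => hw⟩
        · exact ⟨x, fun hx' => absurd hx' hx⟩
      choose f hf using this
      refine ⟨e.1.1, f, fun e' he' => ?_⟩
      obtain rfl := hedge e' e he'
      exact ⟨rfl, hf⟩
    · exact ⟨σ, id, fun e he => absurd ⟨e, he⟩ hσ⟩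
  choose par f hf using hnext
  let X : ℕ → V → E := fun n => Nat.rec (fun _ => x₀) (fun _ Y v => f v (Y (par v))) n
  let x : V → E := fun v => X (T.dist r v) v
  have hxe : ∀ e : RootedEdge T r, x e.1.2 = f e.1.2 (x e.1.1) := by
    intro e
    change X (T.dist r e.1.2) e.1.2 = f e.1.2 (X (T.dist r e.1.1) e.1.1)
    rw [e.2.2, (hf e.1.2 e rfl).1]
  have hxr : x r = x₀ := by
    change X (T.dist r r) r = x₀
    rw [SimpleGraph.dist_self]
    rfl
  have hmem : ∀ n v, T.dist r v = n → x v ∈ B v := by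
    intro n
    induction n with
    | zero =>
      intro v hv
      obtain rfl := hT.connected.dist_eq_zero_iff.1 hv
      rwa [hxr]
    | succ n ih =>
      intro v hv
      have hvr : v ≠ r := by
        rintro rfl
        simp at hv
      obtain ⟨τ, hadj, hd⟩ := hT.connected.exists_adj_dist_eq_add_one hvr
      have hτ := ih τ (by omega)
      have hv' := hxe ⟨(τ, v), hadj, hd⟩
      change x v = f v (x τ) at hv'
      rw [hv']
      exact ((hf v ⟨(τ, v), hadj, hd⟩ rfl).2 _ hτ).1
  refine ⟨x, hxr, fun v => hmem _ v rfl, fun e => ?_⟩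
  rw [hxe]
  exact ((hf e.1.2 e rfl).2 _ (hmem _ _ rfl)).2

/-! ### Choice of the base points -/

theorem Preperfect.infinite {X : Type*} [TopologicalSpace X] [T1Space X] {s : Set X}
    (hs : Preperfect s) (hne : s.Nonempty) : s.Infinite := by
  obtain ⟨x, hx⟩ := hne
  have := hs.perfectSpace_subtype
  have h := infinite_of_mem_nhds (⟨x, hx⟩ : s) Filter.univ_mem
  exact infinite_coe_iff.1 (infinite_univ_iff.1 h)

theorem infinite_irrational_inter_Ioo {x y : ℝ} (h : x < y) :
    ({t | Irrational t} ∩ Ioo x y).Infinite := by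
  intro hfin
  refine not_le.2 h (Cardinal.Real.Ioo_countable_iff.1 ?_)
  refine (hfin.countable.union (countable_range ((↑) : ℚ → ℝ))).mono fun t ht => ?_
  by_cases htq : t ∈ range ((↑) : ℚ → ℝ)
  · exact Or.inr htq
  · exact Or.inl ⟨htq, ht⟩

theorem Set.Infinite.exists_injective_forall_mem {X : Type*} {s : Set X} (hs : s.Infinite)
    (V : Type*) [Finite V] : ∃ f : V → X, Function.Injective f ∧ ∀ v, f v ∈ s := by
  obtain ⟨n, ⟨e⟩⟩ := Finite.exists_equiv_fin V
  exact ⟨fun v => hs.natEmbedding s (e v), fun v w h => e.injective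
    (Fin.val_injective ((hs.natEmbedding s).injective (Subtype.ext h))), fun v => Subtype.prop _⟩

theorem IsOpen.exists_pos_forall_abs_sub_lt {m : ℕ} {U : Set (EuclideanSpace ℝ (Fin m))}
    (hU : IsOpen U) {z : EuclideanSpace ℝ (Fin m)} (hz : z ∈ U) :
    ∃ δ > 0, ∀ w : EuclideanSpace ℝ (Fin m), (∀ k, |w k - z k| < δ) → w ∈ U := by
  have hpre : IsOpen ((WithLp.toLp 2 : (Fin m → ℝ) → EuclideanSpace ℝ (Fin m)) ⁻¹' U) :=
    hU.preimage (PiLp.continuous_toLp 2 _)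
  obtain ⟨δ, hδ, hball⟩ := Metric.isOpen_iff.1 hpre z.ofLp hz
  refine ⟨δ, hδ, fun w hw => ?_⟩
  exact hball (a := w.ofLp) ((dist_pi_lt_iff hδ).2 fun k => hw k)

/-- The pairwise distinct base points around which the configurations are sought differ from each
other in both of the coordinates `i` and `j` along which points will be moved. Moving them keeps
the first half in `K` (as long as coordinate `i` stays in `S`) and the second half irrational. -/
theorem exists_base_points_of_coordinates {d : ℕ} {K : Set (EuclideanSpace ℝ (Fin d))}
    {U : Set (EuclideanSpace ℝ (Fin (d + d)))} (hU : IsOpen U)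
    {z : EuclideanSpace ℝ (Fin (d + d))} (hz : z ∈ U) {i : Fin (d + d)} {j : Fin d}
    (hij : i ≠ Fin.natAdd d j) {S S₀ : Set ℝ} (hS₀S : S₀ ⊆ S)
    (hinf : ∀ δ > 0, (S₀ ∩ Ioo (z i - δ) (z i + δ)).Infinite)
    (hirr : ∀ k, i = Fin.natAdd d k → ∀ p ∈ S₀, Irrational p)
    (hK : ∀ w : EuclideanSpace ℝ (Fin (d + d)), w i ∈ S →
      (∀ k, Fin.castAdd d k ≠ i → w (Fin.castAdd d k) = z (Fin.castAdd d k)) →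
      WithLp.toLp 2 (fun k => w (Fin.castAdd d k)) ∈ K) (V : Type*) [Finite V] :
    ∃ a : V → EuclideanSpace ℝ (Fin (d + d)), (∀ τ, a τ ∈ U) ∧ (∀ τ, a τ i ∈ S) ∧
      (∀ τ, a τ ∈ euclideanProd K (irrationalPoints d)) ∧
      (∀ τ σ, τ ≠ σ → a τ i ≠ a σ i ∧ a τ (Fin.natAdd d j) ≠ a σ (Fin.natAdd d j)) ∧
      ∀ τ, ∀ p ∈ S, ∀ s, Irrational p → Irrational s →
        setTwo (a τ) i (Fin.natAdd d j) p s ∈ euclideanProd K (irrationalPoints d) := by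
  obtain ⟨δ, hδ, hδU⟩ := hU.exists_pos_forall_abs_sub_lt hz
  obtain ⟨α, hα, hαmem⟩ := (hinf δ hδ).exists_injective_forall_mem V
  obtain ⟨β, hβ, hβmem⟩ := (infinite_irrational_inter_Ioo
    (by linarith : z (Fin.natAdd d j) - δ < z (Fin.natAdd d j) + δ)).exists_injective_forall_mem V
  have hc : ∀ k : Fin d, ∃ c, Irrational c ∧ c ∈ Ioo (z (Fin.natAdd d k) - δ)
      (z (Fin.natAdd d k) + δ) := fun k => (infinite_irrational_inter_Ioo (by linarith)).nonempty
  choose c hcirr hcmem using hc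
  let b : EuclideanSpace ℝ (Fin (d + d)) :=
    WithLp.toLp 2 (Fin.addCases (fun k => z (Fin.castAdd d k)) c)
  have hbcast : ∀ k, b (Fin.castAdd d k) = z (Fin.castAdd d k) := fun k => by simp [b]
  have hbnat : ∀ k, b (Fin.natAdd d k) = c k := fun k => by simp [b]
  have hcast : ∀ k : Fin d, Fin.castAdd d k ≠ Fin.natAdd d j := fun k h => by
    have := congrArg Fin.val h
    simp only [Fin.val_castAdd, Fin.val_natAdd] at this
    omega
  have hmem : ∀ p ∈ S, ∀ s, (∀ k, i = Fin.natAdd d k → Irrational p) → Irrational s →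
      setTwo b i (Fin.natAdd d j) p s ∈ euclideanProd K (irrationalPoints d) := by
    intro p hp s hpirr hs
    refine ⟨hK _ ?_ fun k hk => ?_, fun k => ?_⟩
    · rwa [setTwo_apply, if_neg hij, if_pos rfl]
    · rw [setTwo_apply, if_neg (hcast k), if_neg hk, hbcast]
    · change Irrational (setTwo b i (Fin.natAdd d j) p s (Fin.natAdd d k))
      rw [setTwo_apply]
      split_ifs with h1 h2
      · exact hs
      · exact hpirr k h2.symm
      · rw [hbnat]
        exact hcirr k
  refine ⟨fun τ => setTwo b i (Fin.natAdd d j) (α τ) (β τ), fun τ => hδU _ fun k => ?_,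
    fun τ => ?_, fun τ => hmem _ (hS₀S (hαmem τ).1) _ (fun k hk => hirr k hk _ (hαmem τ).1)
      (hβmem τ).1, fun τ σ hne => ⟨?_, ?_⟩, fun τ p hp s hpirr hs => ?_⟩
  · have habs : ∀ t k, t ∈ Ioo (z k - δ) (z k + δ) → |t - z k| < δ := fun t k ht =>
      abs_lt.2 ⟨by linarith [ht.1], by linarith [ht.2]⟩
    rw [setTwo_apply]
    split_ifs with h1 h2
    · subst h1
      exact habs _ _ (hβmem τ).2
    · subst h2
      exact habs _ _ (hαmem τ).2
    · refine Fin.addCases (fun k => ?_) (fun k => ?_) k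
      · rw [hbcast, sub_self, abs_zero]
        exact hδ
      · rw [hbnat]
        exact habs _ _ (hcmem k)
  · rw [setTwo_apply, if_neg hij, if_pos rfl]
    exact hS₀S (hαmem τ).1
  · simp only [setTwo_apply, if_neg hij, if_pos]
    exact hα.ne hne
  · simp only [setTwo_apply, if_pos]
    exact hβ.ne hne
  · have : setTwo (setTwo b i (Fin.natAdd d j) (α τ) (β τ)) i (Fin.natAdd d j) p s =
        setTwo b i (Fin.natAdd d j) p s := by
      ext k
      simp only [setTwo_apply]
      split_ifs <;> rfl
    rw [this]
    exact hmem p hp s (fun _ _ => hpirr) hs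

theorem Perfect.dimension_pos {d : ℕ} {K : Set (EuclideanSpace ℝ (Fin d))} (hK : Perfect K)
    (hne : K.Nonempty) : 0 < d := by
  obtain ⟨x, hx⟩ := hne
  refine Nat.pos_of_ne_zero fun hd => ?_
  subst hd
  obtain ⟨y, -, hyx⟩ := accPt_iff_nhds.1 (hK.acc x hx) univ Filter.univ_mem
  exact hyx (Subsingleton.elim y x)

/-- For `d = 1` the moved coordinates are the one of `K` and the one of the second factor; for
`d ≥ 2` both are taken in the second factor, and then `K` plays no role. -/
theorem exists_base_points {d : ℕ} {K : Set (EuclideanSpace ℝ (Fin d))} (hK : Perfect K)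
    {U : Set (EuclideanSpace ℝ (Fin (d + d)))} (hU : IsOpen U)
    (hUK : (U ∩ euclideanProd K univ).Nonempty) (V : Type*) [Finite V] :
    ∃ (i : Fin (d + d)) (j : Fin d), i ≠ Fin.natAdd d j ∧ ∃ S : Set ℝ, Perfect S ∧
    ∃ a : V → EuclideanSpace ℝ (Fin (d + d)), (∀ τ, a τ ∈ U) ∧ (∀ τ, a τ i ∈ S) ∧
      (∀ τ, a τ ∈ euclideanProd K (irrationalPoints d)) ∧
      (∀ τ σ, τ ≠ σ → a τ i ≠ a σ i ∧ a τ (Fin.natAdd d j) ≠ a σ (Fin.natAdd d j)) ∧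
      ∀ τ, ∀ p ∈ S, ∀ s, Irrational p → Irrational s →
        setTwo (a τ) i (Fin.natAdd d j) p s ∈ euclideanProd K (irrationalPoints d) := by
  obtain ⟨z, hzU, hzK, -⟩ := hUK
  have hd : 0 < d := hK.dimension_pos ⟨_, hzK⟩
  rcases Nat.lt_or_ge 1 d with h2 | h1
  · have hne : (Fin.natAdd d ⟨1, h2⟩ : Fin (d + d)) ≠ Fin.natAdd d ⟨0, hd⟩ := fun h => by
      have := congrArg Fin.val h
      simp at this
    refine ⟨Fin.natAdd d ⟨1, h2⟩, ⟨0, hd⟩, hne, univ, PerfectSpace.univ_perfect ℝ,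
      exists_base_points_of_coordinates hU hzU hne (S₀ := {t | Irrational t}) (subset_univ _)
        (fun δ hδ => infinite_irrational_inter_Ioo (by linarith)) (fun _ _ p hp => hp)
        (fun w _ hw => ?_) V⟩
    have : (fun k => w (Fin.castAdd d k)) = fun k => z (Fin.castAdd d k) := by
      funext k
      refine hw k fun h => ?_
      have := congrArg Fin.val h
      simp only [Fin.val_castAdd, Fin.val_natAdd] at this
      omega
    rw [this]
    exact hzK
  · obtain rfl : d = 1 := by omega
    let S : Set ℝ := {p | WithLp.toLp 2 (fun _ : Fin 1 => p) ∈ K}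
    have hconst : ∀ v : EuclideanSpace ℝ (Fin 1), WithLp.toLp 2 (fun _ : Fin 1 => v 0) = v := by
      intro v
      ext k
      rw [Subsingleton.elim k 0]
    have hS : Perfect S := by
      refine ⟨hK.closed.preimage ((PiLp.continuous_toLp 2 _).comp (by fun_prop)), ?_⟩
      refine preperfect_iff_nhds.2 fun p hp W hW => ?_
      have hpre : (fun v : EuclideanSpace ℝ (Fin 1) => v 0) ⁻¹' W ∈
          nhds (WithLp.toLp 2 (fun _ : Fin 1 => p)) :=
        (by fun_prop : Continuous fun v : EuclideanSpace ℝ (Fin 1) => v 0).continuousAt hW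
      obtain ⟨y, ⟨hyW, hyK⟩, hne⟩ := preperfect_iff_nhds.1 hK.acc _ hp _ hpre
      refine ⟨y 0, ⟨hyW, ?_⟩, fun h => hne ?_⟩
      · change WithLp.toLp 2 (fun _ : Fin 1 => y 0) ∈ K
        rwa [hconst]
      · rw [← hconst y, h]
    have hne : (Fin.castAdd 1 0 : Fin (1 + 1)) ≠ Fin.natAdd 1 0 := by decide
    have hzS : z (Fin.castAdd 1 0) ∈ S := by
      have := hconst (WithLp.toLp 2 fun k => z (Fin.castAdd 1 k))
      change WithLp.toLp 2 (fun _ : Fin 1 => z (Fin.castAdd 1 0)) ∈ K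
      exact this ▸ hzK
    refine ⟨Fin.castAdd 1 0, 0, hne, S, hS,
      exists_base_points_of_coordinates hU hzU hne (S₀ := S) subset_rfl (fun δ hδ => ?_)
        (fun k hk => ?_) (fun w hw _ => ?_) V⟩
    · rw [inter_comm]
      exact (hS.acc.open_inter isOpen_Ioo).infinite ⟨_, ⟨by linarith, by linarith⟩, hzS⟩
    · exact absurd hk (by rw [Subsingleton.elim k 0]; exact hne)
    · exact hconst (WithLp.toLp 2 fun k => w (Fin.castAdd 1 k)) ▸ hw

/-! ### Assembling the distance set -/

theorem exists_pos_forall_of_finite {ι : Type*} [Finite ι] {P : ι → ℝ → Prop}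
    (h : ∀ i, ∃ ε > 0, ∀ ε' > 0, ε' ≤ ε → P i ε') : ∃ ε > 0, ∀ ε' > 0, ε' ≤ ε → ∀ i, P i ε' := by
  choose ε hε hP using h
  have hev : ∀ᶠ t in nhdsWithin (0 : ℝ) (Ioi 0), ∀ i, t ≤ ε i :=
    Filter.eventually_all.2 fun i =>
      Filter.mem_of_superset (Ioc_mem_nhdsGT (hε i)) fun t ht => ht.2
  obtain ⟨t, ht, ht0⟩ := (hev.and self_mem_nhdsWithin).exists
  exact ⟨t, ht0, fun ε' hε' hle i => hP i ε' hε' (hle.trans (ht i))⟩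

theorem theorem2p9 (d : ℕ)
    (φ : EuclideanSpace ℝ (Fin (d + d)) → EuclideanSpace ℝ (Fin (d + d)) → ℝ)
    (U : Set (EuclideanSpace ℝ (Fin (d + d)))) (hφ : DerivativeConditionOn φ U)
    (K : Set (EuclideanSpace ℝ (Fin d))) (hK : IsCantorSet K)
    (hUK : (U ∩ euclideanProd K univ).Nonempty)
    {V : Type*} [Finite V] (T : SimpleGraph V) (hT : T.IsTree) (r : V) :
    ∃ K' : Set (EuclideanSpace ℝ (Fin d)), IsCantorSet K' ∧ volume K < volume K' ∧
      ∃ y ∈ euclideanProd K K',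
        (interior (pinnedTreeSet φ T r (euclideanProd K K') y)).Nonempty := by
  have : Finite (RootedEdge T r) := Subtype.finite
  have hd := hK.perfect.dimension_pos hK.nonempty
  obtain ⟨i, j, hij, S, hS, a, haU, haS, haK, hane, hmove⟩ :=
    exists_base_points hK.perfect hφ.isOpen hUK V
  obtain ⟨ρ, hρ, hsep⟩ : ∃ ρ > 0, ∀ τ σ, τ ≠ σ → 2 * ρ < dist (a τ) (a σ) := by
    obtain ⟨ρ, hρ, h⟩ := exists_pos_forall_of_finite (ι := V × V)
      (P := fun q ρ => q.1 ≠ q.2 → 2 * ρ < dist (a q.1) (a q.2)) fun q => by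
        by_cases hq : q.1 = q.2
        · exact ⟨1, one_pos, fun _ _ _ h => absurd hq h⟩
        · have hpos : 0 < dist (a q.1) (a q.2) :=
            dist_pos.2 fun h => (hane _ _ hq).1 (by rw [h])
          exact ⟨dist (a q.1) (a q.2) / 3, by positivity, fun ε' _ hle _ => by linarith⟩
    exact ⟨ρ, hρ, fun τ σ => h ρ hρ le_rfl (τ, σ)⟩
  -- one step towards the root: a radius for the parents that serves all edges at once
  have hstep : ∀ R : {R : ℝ // 0 < R}, ∃ R' : {R : ℝ // 0 < R}, R'.1 ≤ R.1 ∧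
      ∀ e : RootedEdge T r, ∃ J : Set ℝ, IsOpen J ∧ J.Nonempty ∧
        ∃ M : Set (EuclideanSpace ℝ (Fin (d + d))), IsCompact M ∧
          M ⊆ Metric.closedBall (a e.1.2) R ∧ M ⊆ euclideanProd K (irrationalPoints d) ∧
          ∀ x ∈ Metric.closedBall (a e.1.1) R', ∀ t ∈ J, ∃ w ∈ M, φ x w = t := by
    rintro ⟨R, hR⟩
    obtain ⟨ε, hε, h⟩ := exists_pos_forall_of_finite (ι := RootedEdge T r)
      (P := fun e ε => ∃ J : Set ℝ, IsOpen J ∧ J.Nonempty ∧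
        ∃ M : Set (EuclideanSpace ℝ (Fin (d + d))), IsCompact M ∧
          M ⊆ Metric.closedBall (a e.1.2) R ∧ M ⊆ euclideanProd K (irrationalPoints d) ∧
          ∀ x ∈ Metric.closedBall (a e.1.1) ε, ∀ t ∈ J, ∃ w ∈ M, φ x w = t) fun e => by
        obtain ⟨hi, hj⟩ := hane e.1.1 e.1.2 e.2.1.ne
        obtain ⟨A, B, hA, hB, -, -, haA, haB, hcont, hder⟩ := hφ.exists_nhds _ (haU e.1.1) _
          (haU e.1.2) fun h => hi (by rw [h])
        obtain ⟨R', hR', J, hJo, hJne, M, hM, hMball, hMform, hMsol⟩ :=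
          exists_isCompact_forall_exists_eq hA hB haA haB hcont hij (hder i hi).1 (hder _ hj).1
            hS (haS e.1.2) hR
        refine ⟨R', hR', fun ε' _ hle => ⟨J, hJo, hJne, M, hM, hMball, fun w hw => ?_,
          fun x hx => hMsol x (Metric.closedBall_subset_closedBall hle hx)⟩⟩
        obtain ⟨p, hp, s, hpirr, hsirr, rfl⟩ := hMform w hw
        exact hmove e.1.2 p hp s hpirr hsirr
    exact ⟨⟨min ε R, lt_min hε hR⟩, min_le_right _ _, h _ (lt_min hε hR) (min_le_left _ _)⟩
  choose f hfle hf using hstep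
  let δ : ℕ → {R : ℝ // 0 < R} := fun n => Nat.rec ⟨ρ, hρ⟩ (fun _ R => f R) n
  have hδρ : ∀ n, (δ n).1 ≤ ρ := by
    intro n
    induction n with
    | zero => exact le_rfl
    | succ n ih => exact (hfle (δ n)).trans ih
  obtain ⟨N, hN⟩ := (finite_range fun v => T.dist r v).bddAbove
  have hNd : ∀ v, T.dist r v ≤ N := fun v => hN ⟨v, rfl⟩
  -- radii decrease towards the root, since a parent must be controlled in terms of its children
  let rad : V → ℝ := fun v => (δ (N - T.dist r v)).1
  have hedge : ∀ e : RootedEdge T r, ∃ J : Set ℝ, IsOpen J ∧ J.Nonempty ∧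
      ∃ M : Set (EuclideanSpace ℝ (Fin (d + d))), IsCompact M ∧
        M ⊆ Metric.closedBall (a e.1.2) (rad e.1.2) ∧ M ⊆ euclideanProd K (irrationalPoints d) ∧
        ∀ x ∈ Metric.closedBall (a e.1.1) (rad e.1.1), ∀ t ∈ J, ∃ w ∈ M, φ x w = t := by
    intro e
    have hrad : rad e.1.1 = (f (δ (N - T.dist r e.1.2))).1 := by
      have h1 := hNd e.1.2
      have h2 := e.2.2
      have h3 : N - T.dist r e.1.1 = (N - T.dist r e.1.2) + 1 := by omega
      change (δ (N - T.dist r e.1.1)).1 = _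
      rw [h3]
    rw [hrad]
    exact hf (δ (N - T.dist r e.1.2)) e
  choose J hJo hJne M hMc hMball hMK hMsol using hedge
  let snd : EuclideanSpace ℝ (Fin (d + d)) → EuclideanSpace ℝ (Fin d) :=
    fun z => WithLp.toLp 2 fun k => z (Fin.natAdd d k)
  have hsnd : Continuous snd := (PiLp.continuous_toLp 2 _).comp (by fun_prop)
  have hL : IsCompact (snd '' ((⋃ e, M e) ∪ {a r})) :=
    ((isCompact_iUnion hMc).union isCompact_singleton).image hsnd
  have hLirr : snd '' ((⋃ e, M e) ∪ {a r}) ⊆ irrationalPoints d := by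
    rintro _ ⟨w, hw | rfl, rfl⟩
    · obtain ⟨e, he⟩ := mem_iUnion.1 hw
      exact (hMK e he).2
    · exact (haK r).2
  obtain ⟨K', hK', hLK', hvol⟩ := exists_isCantorSet_superset hd hL
    ⟨_, a r, Or.inr rfl, rfl⟩ hLirr (hK.isCompact.measure_lt_top (μ := volume))
  have har : a r ∈ euclideanProd K K' := ⟨(haK r).1, hLK' ⟨a r, Or.inr rfl, rfl⟩⟩
  have hMK' : ∀ e, M e ⊆ euclideanProd K K' := fun e w hw =>
    ⟨(hMK e hw).1, hLK' ⟨w, Or.inl (mem_iUnion.2 ⟨e, hw⟩), rfl⟩⟩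
  refine ⟨K', hK', hvol, a r, har, ?_⟩
  refine ((univ_pi_nonempty_iff (t := J)).2 hJne).mono
    (interior_maximal (fun l hl => ?_) (isOpen_set_pi finite_univ fun e _ => hJo e))
  obtain ⟨x, hxr, hxB, hx⟩ := exists_family_of_forall_edge hT r
    (fun v => Metric.closedBall (a v) (rad v) ∩ euclideanProd K K') (fun e x w => l e = φ x w)
    ⟨Metric.mem_closedBall_self (δ _).2.le, har⟩ fun e x hx => by
      obtain ⟨w, hw, hwt⟩ := hMsol e x hx.1 (l e) (hl e (mem_univ e))
      exact ⟨w, ⟨hMball e hw, hMK' e hw⟩, hwt.symm⟩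
  refine ⟨x, fun τ σ heq => ?_, fun τ => (hxB τ).2, hxr, hx⟩
  by_contra hne
  have h1 : dist (x τ) (a τ) ≤ ρ := le_trans (hxB τ).1 (hδρ _)
  have h2 : dist (x σ) (a σ) ≤ ρ := le_trans (hxB σ).1 (hδρ _)
  rw [← heq] at h2
  have h3 := hsep τ σ hne
  have h4 := dist_triangle_left (a τ) (a σ) (x τ)
  linarith
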